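/- Let $X$ and $U$ be real Banach spaces, where $X$ is separable and is an ordered Banach space whose positive cone $X_+=\{x\in X: x\ge 0\}$ is a closed convex cone with $X_+\cap(-X_+)=\{0\}$ and $\mathrm{Int}(X_+)\neq\emptyset$. For every $t\in\mathbb N=\{0,1,2,\dots\}$ let $X_t\subset X$ be nonempty and open, let $U_t\subset U$ be nonempty and convex, and let $f_t:X_t\times U_t\to X_{t+1}$ and $\phi_t:X_t\times U_t\to\mathbb R$ be mappings. Fix $\sigma\in X_0$, and let $\mathrm{Iad}(\sigma)$ be the set of all processes $((x_t)_{t\in\mathbb N},(u_t)_{t\in\mathbb N})\in\prod_t X_t\times\prod_t U_t$ with $x_0=\sigma$ and $x_{t+1}\le f_t(x_t,u_t)$ for all $t\in\mathbb N$. Let $((\hat x_t)_{t},(\hat u_t)_{t})\in\mathrm{Iad}(\sigma)$ be optimal in at least one of the following three senses: - the series $\sum_{t=0}^{\infty}\phi_t(\hat x_t,\hat u_t)$ converges in $\mathbb R$, and its sum is at least $\sum_{t=0}^\infty\phi_t(x_t,u_t)$ for every process in $\mathrm{Iad}(\sigma)$ for which the latter series converges in $\mathbb R$; - $\limsup_{T\to\infty}\sum_{t=0}^T(\phi_t(\hat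 x_t,\hat u_t)-\phi_t(x_t,u_t))\ge 0$ for every process in $\mathrm{Iad}(\sigma)$; - $\liminf_{T\to\infty}\sum_{t=0}^T(\phi_t(\hat x_t,\hat u_t)-\phi_t(x_t,u_t))\ge 0$ for every process in $\mathrm{Iad}(\sigma)$. A mapping on $X_t\times U_t$ is called (continuously) Fréchet differentiable at $(\hat x_t,\hat u_t)$ if it coincides, on the intersection of $X_t\times U_t$ with an open neighborhood of this point, with a mapping defined on that neighborhood which is Fréchet differentiable at the point (respectively, Fréchet differentiable on the neighborhood with differential continuous at the point); its differential $D$ at $(\hat x_t,\hat u_t)$ is that of such an extension, fixed once and for all, and $D_1,D_2$ are the corresponding partial differentials. Let $T_{U_t}(\hat u_t)=\overline{\{\alpha(v-\hat u_t):\alpha\ge 0,\ v\in U_t\}}$, and let $B_{X\times U}$ be the closed unit ball of $X\times U$. Assume: - for all $t\in\mathbb N$, $\phi_t$ is Fréchet differentiable and $f_t$ is continuously Fréchet differentiable at $(\hat x_t,\hat u_t)$; - for all $t\ge 1$, $0\in\mathrm{Int}\big[Df_t(\hat x_t,\hat u_t)\big((X\times T_{U_t}(\hat u_t))\cap B_{X\times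 U}\big)\big]$; - for all $t\in\mathbb N$, the range of $D_2f_t(\hat x_t,\hat u_t)$ is closed and of finite codimension in $X$; - $s\in\mathbb N$ is such that $D_2f_s(\hat x_s,\hat u_s)(T_{U_s}(\hat u_s))$ contains a closed convex set $K$ which has nonempty interior relative to its affine hull $\mathrm{Aff}(K)$, and such that $\overline{\mathrm{Aff}(K)}$ has finite codimension in $X$. Then there exist $\lambda_0\in\mathbb R$ and a sequence $(p_t)_{t\ge 1}$ in $X^*$ such that 1. $(\lambda_0,p_t)\neq(0,0)$ for all $t\ge 1$ with $t\ge s$; 2. $\lambda_0\ge 0$, and $p_t\ge 0$ (that is, $p_t(h)\ge 0$ for all $h\in X_+$) for all $t\ge 1$; 3. $p_t=p_{t+1}\circ D_1f_t(\hat x_t,\hat u_t)+\lambda_0 D_1\phi_t(\hat x_t,\hat u_t)$ for all $t\ge 1$; 4. $\langle\lambda_0D_2\phi_t(\hat x_t,\hat u_t)+p_{t+1}\circ D_2f_t(\hat x_t,\hat u_t),\,v-\hat u_t\rangle\le 0$ for all $t\in\mathbb N$ and all $v\in U_t$. -/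

import Mathlib

namespace DiscreteControl

open Filter Topology

/-- `f` has Fréchet derivative `f'` at `z` as a mapping given on `S` only: on some open neighborhood
`N` of `z` there is a mapping `g` which equals `f` on `N ∩ S` and is Fréchet differentiable at `z`
with derivative `f'`. Values of `f` outside `S` are irrelevant. -/
def HasExtFDerivAt {E F : Type*} [NormedAddCommGroup E] [NormedSpace ℝ E]
    [NormedAddCommGroup F] [NormedSpace ℝ F]
    (f : E → F) (S : Set E) (f' : E →L[ℝ] F) (z : E) : Prop :=
  ∃ (N : Set E) (g : E → F), IsOpen N ∧ z ∈ N ∧ Set.EqOn g f (N ∩ S) ∧ HasFDerivAt g f' z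

/-- The same for continuous Fréchet differentiability at `z`: the extension `g` is differentiable on
the open neighborhood `N`, its derivative is continuous at `z`, and equals `f'` there. -/
def HasContExtFDerivAt {E F : Type*} [NormedAddCommGroup E] [NormedSpace ℝ E]
    [NormedAddCommGroup F] [NormedSpace ℝ F]
    (f : E → F) (S : Set E) (f' : E →L[ℝ] F) (z : E) : Prop :=
  ∃ (N : Set E) (g : E → F), IsOpen N ∧ z ∈ N ∧ Set.EqOn g f (N ∩ S) ∧
    (∀ w ∈ N, DifferentiableAt ℝ g w) ∧ ContinuousAt (fderiv ℝ g) z ∧ fderiv ℝ g z = f'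

/-- The partial differential with respect to the first variable. -/
def D₁ {X U F : Type*} [NormedAddCommGroup X] [NormedSpace ℝ X] [NormedAddCommGroup U]
    [NormedSpace ℝ U] [NormedAddCommGroup F] [NormedSpace ℝ F]
    (L : X × U →L[ℝ] F) : X →L[ℝ] F :=
  L.comp (ContinuousLinearMap.inl ℝ X U)

/-- The partial differential with respect to the second variable. -/
def D₂ {X U F : Type*} [NormedAddCommGroup X] [NormedSpace ℝ X] [NormedAddCommGroup U]
    [NormedSpace ℝ U] [NormedAddCommGroup F] [NormedSpace ℝ F]
    (L : X × U →L[ℝ] F) : U →L[ℝ] F :=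
  L.comp (ContinuousLinearMap.inr ℝ X U)

/-- The tangent cone `closure {α (v - u) : α ≥ 0, v ∈ A}` of `A` at `u`. -/
def tangentCone {U : Type*} [NormedAddCommGroup U] [NormedSpace ℝ U] (A : Set U) (u : U) : Set U :=
  closure {w | ∃ α : ℝ, 0 ≤ α ∧ ∃ v ∈ A, w = α • (v - u)}

/-- The closure of the affine hull of `K` has finite codimension. (For nonempty `K`, this closure is
a translate of the closure of the direction of the affine hull.) -/
def AffineHullFiniteCodim {X : Type*} [NormedAddCommGroup X] [NormedSpace ℝ X]
    (K : Set X) : Prop :=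
  FiniteDimensional ℝ (X ⧸ (affineSpan ℝ K).direction.topologicalClosure)

/-- State sets `X_t`, control sets `U_t`, mappings `f_t : X_t × U_t → X_{t+1}` and rewards
`φ_t : X_t × U_t → ℝ`. Only the values of `f_t` and `φ_t` on `X_t × U_t` matter. -/
structure ControlSystem (X U : Type*) where
  stateSet : ℕ → Set X
  controlSet : ℕ → Set U
  f : ℕ → X × U → X
  φ : ℕ → X × U → ℝ
  mapsTo : ∀ t, Set.MapsTo (f t) (stateSet t ×ˢ controlSet t) (stateSet (t + 1))

namespace ControlSystem

variable {X U : Type*}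

/-- The processes governed by the difference inequality and starting at `σ`. -/
def Iad [LE X] (P : ControlSystem X U) (σ : X) : Set ((ℕ → X) × (ℕ → U)) :=
  {z | (∀ t, z.1 t ∈ P.stateSet t) ∧ (∀ t, z.2 t ∈ P.controlSet t) ∧ z.1 0 = σ ∧
    ∀ t, z.1 (t + 1) ≤ P.f t (z.1 t, z.2 t)}

/-- The partial sum `∑_{t=0}^T φ_t(x_t, u_t)`. -/
def partialSum (P : ControlSystem X U) (z : (ℕ → X) × (ℕ → U)) (T : ℕ) : ℝ :=
  ∑ t ∈ Finset.range (T + 1), P.φ t (z.1 t, z.2 t)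

/-- The series `∑_{t=0}^∞ φ_t(x_t, u_t)` converges in `ℝ`, with sum `J`. -/
def HasValue (P : ControlSystem X U) (z : (ℕ → X) × (ℕ → U)) (J : ℝ) : Prop :=
  Tendsto (P.partialSum z) atTop (𝓝 J)

/-- Among the admissible processes whose series converges, `z` maximizes the sum. -/
def IsOptimal₁ [LE X] (P : ControlSystem X U) (σ : X) (z : (ℕ → X) × (ℕ → U)) : Prop :=
  z ∈ P.Iad σ ∧ ∃ J, P.HasValue z J ∧ ∀ y ∈ P.Iad σ, ∀ J', P.HasValue y J' → J' ≤ J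

/-- `limsup_T ∑_{t=0}^T (φ_t(z_t) - φ_t(y_t)) ≥ 0` for all admissible `y`, the limsup being taken
in the extended reals. -/
def IsOptimal₂ [LE X] (P : ControlSystem X U) (σ : X) (z : (ℕ → X) × (ℕ → U)) : Prop :=
  z ∈ P.Iad σ ∧ ∀ y ∈ P.Iad σ,
    0 ≤ limsup (fun T : ℕ => ((∑ t ∈ Finset.range (T + 1),
      (P.φ t (z.1 t, z.2 t) - P.φ t (y.1 t, y.2 t)) : ℝ) : EReal)) atTop

/-- `liminf_T ∑_{t=0}^T (φ_t(z_t) - φ_t(y_t)) ≥ 0` for all admissible `y`, the liminf being taken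
in the extended reals. -/
def IsOptimal₃ [LE X] (P : ControlSystem X U) (σ : X) (z : (ℕ → X) × (ℕ → U)) : Prop :=
  z ∈ P.Iad σ ∧ ∀ y ∈ P.Iad σ,
    0 ≤ liminf (fun T : ℕ => ((∑ t ∈ Finset.range (T + 1),
      (P.φ t (z.1 t, z.2 t) - P.φ t (y.1 t, y.2 t)) : ℝ) : EReal)) atTop

end ControlSystem

end DiscreteControl

open DiscreteControl Filter Topology

/-! Perturb the optimal process only at times up to `T`, keeping the initial state and everything
after `T` fixed. In all three senses of optimality, no such admissible perturbation improves the
finite sum. So the convex set of linearized (gain, slacks) misses the interior of the positive cone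
of `ℝ × X^(T+1)`, and Hahn-Banach separation gives multipliers for horizon `T`
(`exists_isMultiplierUpTo`). Fix `e` in the interior of `X_+`. A positive functional satisfies `‖p‖
≤ p e / r`, so normalizing by `l + p 1 e = 1` bounds `p 1`; the interior condition on `Df t` then
bounds `p (t + 1)` in terms of `p t` (`opNorm_succ_le`), uniformly in `T`. Weak-star limits along an
ultrafilter keep every condition and also the normalization. If `l₀` and some `p t` vanished, the
adjoint equation run backwards would give `p 1 = 0`, contradicting `l₀ + p 1 e = 1`. -/

theorem DiscreteControl.HasContExtFDerivAt.hasExtFDerivAt {E F : Type*}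
    [NormedAddCommGroup E] [NormedSpace ℝ E] [NormedAddCommGroup F] [NormedSpace ℝ F]
    {f : E → F} {S : Set E} {f' : E →L[ℝ] F} {z : E} (h : HasContExtFDerivAt f S f' z) :
    HasExtFDerivAt f S f' z := by
  obtain ⟨N, g, hN, hz, hg, hd, -, rfl⟩ := h
  exact ⟨N, g, hN, hz, hg, (hd z hz).hasFDerivAt⟩

/-- The limit is one-sided because convexity of a control set keeps only `ε ∈ [0, 1]` admissible. -/
theorem DiscreteControl.HasExtFDerivAt.tendsto_slope {E F : Type*}
    [NormedAddCommGroup E] [NormedSpace ℝ E] [NormedAddCommGroup F] [NormedSpace ℝ F]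
    {f : E → F} {S : Set E} {f' : E →L[ℝ] F} {z d : E} (h : HasExtFDerivAt f S f' z)
    (hz : z ∈ S) (hd : ∀ᶠ ε : ℝ in 𝓝[>] 0, z + ε • d ∈ S) :
    Tendsto (fun ε : ℝ => ε⁻¹ • (f (z + ε • d) - f z)) (𝓝[>] 0) (𝓝 (f' d)) := by
  obtain ⟨N, g, hN, hzN, hg, hd'⟩ := h
  have h1 : HasDerivAt (fun ε : ℝ => g (z + ε • d)) (f' d) 0 := hd'.hasLineDerivAt d
  have h2 := h1.tendsto_slope_zero_right
  refine h2.congr' ?_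
  have hc : Tendsto (fun ε : ℝ => z + ε • d) (𝓝[>] 0) (𝓝 z) := by
    have : ContinuousAt (fun ε : ℝ => z + ε • d) 0 := by fun_prop
    simpa using this.tendsto.mono_left nhdsWithin_le_nhds
  filter_upwards [hd, hc (hN.mem_nhds hzN)] with ε h3 h4
  simp [hg ⟨h4, h3⟩, hg ⟨hzN, hz⟩]

theorem ContinuousLinearMap.opNorm_le_div_of_le {X : Type*} [NormedAddCommGroup X]
    [NormedSpace ℝ X] {p : X →L[ℝ] ℝ} {r c : ℝ} (hr : 0 < r)
    (h : ∀ z ∈ Metric.closedBall (0 : X) r, p z ≤ c) : ‖p‖ ≤ c / r := by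
  have hc : 0 ≤ c := by simpa using h 0 (Metric.mem_closedBall_self hr.le)
  refine p.opNorm_le_bound (by positivity) fun z => ?_
  refine LinearMap.bound_of_ball_bound' hr c (p : X →ₗ[ℝ] ℝ) (fun z hz => ?_) z
  refine abs_le.2 ⟨?_, h z hz⟩
  have := h (-z) (by simpa using hz)
  simp only [map_neg] at this
  simpa using neg_le.1 this

/-- The norm of a positive functional is controlled by its value at an interior point of the cone.
Hence weak-star limits of normalized positive functionals do not vanish, without any finite
codimension or separability hypothesis. -/
theorem exists_pos_opNorm_le_of_mem_interior {X : Type*} [NormedAddCommGroup X]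
    [NormedSpace ℝ X] [PartialOrder X] {e : X} (he : e ∈ interior (Set.Ici (0 : X))) :
    ∃ r > 0, ∀ p : X →L[ℝ] ℝ, (∀ h, 0 ≤ h → 0 ≤ p h) → ‖p‖ ≤ p e / r := by
  obtain ⟨r, hr, h⟩ := Metric.nhds_basis_closedBall.mem_iff.1 (mem_interior_iff_mem_nhds.1 he)
  refine ⟨r, hr, fun p hp => ContinuousLinearMap.opNorm_le_div_of_le hr fun z hz => ?_⟩
  have := hp (e - z) (h (by simpa using hz))
  rw [map_sub] at this
  linarith

/-! ### Separation from the positive cone -/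

section Cone

variable {X : Type*} [NormedAddCommGroup X] [NormedSpace ℝ X] [PartialOrder X]
  [IsOrderedAddMonoid X] [IsOrderedModule ℝ X]

/-- The vector is the convex combination `(1 - ε) g + ε (g + q ε)` of nonnegative vectors. Here `g`
is the current slack in the inequality and `q` a difference quotient. -/
theorem eventually_nonneg_add_smul {g w : X} {q : ℝ → X} (hg : 0 ≤ g)
    (hw : g + w ∈ interior (Set.Ici (0 : X))) (hq : Tendsto q (𝓝[>] 0) (𝓝 w)) :
    ∀ᶠ ε : ℝ in 𝓝[>] 0, 0 ≤ g + ε • q ε := by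
  have h1 : ∀ᶠ ε : ℝ in 𝓝[>] 0, g + q ε ∈ Set.Ici (0 : X) :=
    (tendsto_const_nhds.add hq) (mem_interior_iff_mem_nhds.1 hw)
  have h2 : ∀ᶠ ε : ℝ in 𝓝[>] 0, ε ≤ 1 := nhdsWithin_le_nhds (eventually_le_nhds one_pos)
  filter_upwards [h1, h2, self_mem_nhdsWithin] with ε h1 h2 h3
  have : g + ε • q ε = (1 - ε) • g + ε • (g + q ε) := by module
  rw [this]
  exact add_nonneg (smul_nonneg (sub_nonneg.2 h2) hg) (smul_nonneg (le_of_lt h3) h1)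

/-- Separation of a convex set from the interior of the positive cone of `ℝ × Xⁿ`. -/
theorem exists_nonneg_multipliers (hX : IsClosed (Set.Ici (0 : X)))
    (hXint : (interior (Set.Ici (0 : X))).Nonempty) {n : ℕ} {C : Set (ℝ × (Fin n → X))}
    (hC : Convex ℝ C) (hC0 : C.Nonempty)
    (hdisj : ∀ c ∈ C, ¬ (0 < c.1 ∧ ∀ i, c.2 i ∈ interior (Set.Ici (0 : X)))) :
    ∃ (l : ℝ) (p : Fin n → X →L[ℝ] ℝ), 0 ≤ l ∧ (∀ i h, 0 ≤ h → 0 ≤ p i h) ∧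
      (l ≠ 0 ∨ ∃ i, p i ≠ 0) ∧ ∀ c ∈ C, l * c.1 + ∑ i, p i (c.2 i) ≤ 0 := by
  classical
  obtain ⟨e, he⟩ := hXint
  have hconv : Convex ℝ (Set.Ici (0 : X)) := convex_Ici 0
  set S : Set (ℝ × (Fin n → X)) :=
    Set.Ioi 0 ×ˢ Set.univ.pi fun _ => interior (Set.Ici (0 : X)) with hS
  have hSconv : Convex ℝ S := (convex_Ioi 0).prod (convex_pi fun _ _ => hconv.interior)
  have hSopen : IsOpen S :=
    isOpen_Ioi.prod (isOpen_set_pi Set.finite_univ fun _ _ => isOpen_interior)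
  have hScl (w : ℝ × (Fin n → X)) : w ∈ closure S ↔ 0 ≤ w.1 ∧ ∀ i, 0 ≤ w.2 i := by
    rw [hS, closure_prod_eq, closure_Ioi, closure_pi_set,
      hconv.closure_interior_eq_closure_of_nonempty_interior ⟨e, he⟩, hX.closure_eq]
    simp only [Set.mem_prod, Set.mem_Ici, Set.mem_pi, Set.mem_univ, true_imp_iff]
  have hSC : Disjoint S C := Set.disjoint_left.2 fun c hc hc' =>
    hdisj c hc' ⟨hc.1, fun i => hc.2 i trivial⟩
  obtain ⟨F, b, hFS, hFC⟩ := geometric_hahn_banach_open hSconv hSopen hC hSC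
  have hFcl : ∀ w ∈ closure S, F w ≤ b := fun w hw =>
    closure_minimal (fun a ha => (hFS a ha).le) (isClosed_le F.continuous continuous_const) hw
  have hb : 0 ≤ b := by
    simpa using hFcl 0 ((hScl _).2 ⟨le_rfl, fun _ => le_rfl⟩)
  -- A functional bounded above on a cone is nonpositive there: scale by large `k`.
  have hneg : ∀ w ∈ closure S, F w ≤ 0 := by
    intro w hw
    by_contra! hlt
    obtain ⟨k, hk⟩ := exists_nat_gt (b / F w)
    rw [div_lt_iff₀ hlt] at hk
    have := hFcl ((k : ℝ) • w) (by
      rw [hScl] at hw ⊢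
      exact ⟨mul_nonneg k.cast_nonneg hw.1, fun i =>
        smul_nonneg (Nat.cast_nonneg (α := ℝ) k) (hw.2 i)⟩)
    simp only [map_smul, smul_eq_mul] at this
    linarith
  have hdec : ∀ c : ℝ × (Fin n → X),
      F c = c.1 * F (1, 0) + ∑ i, F (0, Pi.single i (c.2 i)) := by
    intro c
    have h1 : c = c.1 • ((1 : ℝ), (0 : Fin n → X))
        + ∑ i, ContinuousLinearMap.inr ℝ ℝ (Fin n → X) (Pi.single i (c.2 i)) := by
      rw [← map_sum, Finset.univ_sum_single]
      ext <;> simp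
    have h2 : F (c.1 • ((1 : ℝ), (0 : Fin n → X))) = c.1 * F (1, 0) := F.map_smul _ _
    conv_lhs => rw [h1, map_add, h2, map_sum]
    rfl
  refine ⟨-F (1, 0), fun i => -(F.comp ((ContinuousLinearMap.inr ℝ ℝ (Fin n → X)).comp
    (ContinuousLinearMap.single ℝ (fun _ : Fin n => X) i))), ?_, ?_, ?_, ?_⟩
  · have := hneg (1, 0) ((hScl _).2 ⟨zero_le_one, fun _ => le_rfl⟩)
    linarith
  · intro i h hh
    have := hneg (0, Pi.single i h) (by
      rw [hScl]
      refine ⟨le_rfl, fun j => ?_⟩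
      rcases eq_or_ne j i with rfl | hj
      · simpa using hh
      · simp [hj])
    simpa using this
  -- Vanishing multipliers force `F = 0`, against the strict inequality `F < b ≤ F` between a point
  -- of `S` and a point of `C`.
  · by_contra! h
    obtain ⟨h1, h2⟩ := h
    have hF : ∀ c, F c = 0 := by
      intro c
      rw [hdec, neg_eq_zero.1 h1, mul_zero, zero_add]
      refine Finset.sum_eq_zero fun i _ => ?_
      simpa using congrArg (fun q : X →L[ℝ] ℝ => q (c.2 i)) (h2 i)
    obtain ⟨c, hc⟩ := hC0
    have h3 := hFC c hc
    have h4 := hFS (1, fun _ => e) ⟨by simp, fun i _ => he⟩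
    rw [hF] at h3 h4
    linarith
  · intro c hc
    have h3 := hFC c hc
    rw [hdec] at h3
    simp only [neg_apply, ContinuousLinearMap.comp_apply,
      Finset.sum_neg_distrib]
    simp only [ContinuousLinearMap.inr_apply, ContinuousLinearMap.single_apply]
    linarith

end Cone

/-! ### Finite-horizon consequences of optimality -/

section FiniteHorizon

variable {X U : Type*} {P : ControlSystem X U} {σ : X} {x : ℕ → X} {u : ℕ → U}

/-- Each kind of optimality over the infinite horizon passes to finite horizons with the final state
held fixed. -/
theorem partialSum_le_of_optimal [LE X]
    (hopt : P.IsOptimal₁ σ (x, u) ∨ P.IsOptimal₂ σ (x, u) ∨ P.IsOptimal₃ σ (x, u))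
    {y : (ℕ → X) × (ℕ → U)} (hy : y ∈ P.Iad σ) {T : ℕ}
    (h : ∀ t, T < t → y.1 t = x t ∧ y.2 t = u t) :
    P.partialSum y T ≤ P.partialSum (x, u) T := by
  have hsum : ∀ n, T ≤ n → P.partialSum (x, u) n - P.partialSum y n
      = P.partialSum (x, u) T - P.partialSum y T := by
    intro n hn
    induction n, hn using Nat.le_induction with
    | base => rfl
    | succ n hn ih =>
      rw [← ih]
      simp only [ControlSystem.partialSum]
      rw [Finset.sum_range_succ _ (n + 1), Finset.sum_range_succ _ (n + 1),
        (h (n + 1) (by omega)).1, (h (n + 1) (by omega)).2]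
      ring
  have hev : (fun n : ℕ => ((∑ t ∈ Finset.range (n + 1),
      (P.φ t (x t, u t) - P.φ t (y.1 t, y.2 t)) : ℝ) : EReal)) =ᶠ[atTop]
      fun _ => ((P.partialSum (x, u) T - P.partialSum y T : ℝ) : EReal) := by
    filter_upwards [eventually_ge_atTop T] with n hn
    rw [← hsum n hn, Finset.sum_sub_distrib]
    rfl
  rw [← sub_nonneg]
  rcases hopt with ⟨-, J, hJ, hmax⟩ | ⟨-, hmax⟩ | ⟨-, hmax⟩
  -- The two processes share their tail, so the competitor's series converges too and may be
  -- compared.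
  · have hyJ : P.HasValue y (J - (P.partialSum (x, u) T - P.partialSum y T)) := by
      refine (Tendsto.sub_const hJ (P.partialSum (x, u) T - P.partialSum y T)).congr' ?_
      filter_upwards [eventually_ge_atTop T] with n hn
      rw [← hsum n hn]
      ring
    have := hmax y hy _ hyJ
    linarith
  · have := hmax y hy
    rw [limsup_congr hev, limsup_const] at this
    exact_mod_cast this
  · have := hmax y hy
    rw [liminf_congr hev, liminf_const] at this
    exact_mod_cast this

variable [NormedAddCommGroup X] [NormedSpace ℝ X] [PartialOrder X]
  [IsOrderedAddMonoid X] [IsOrderedModule ℝ X] [NormedAddCommGroup U] [NormedSpace ℝ U]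
  {Dφ : ℕ → X × U →L[ℝ] ℝ} {Df : ℕ → X × U →L[ℝ] X}

/-- Otherwise a small step `ε` along `(y, w)` would be admissible and strictly better. Interior
slack absorbs the linearization error, and one `ε` serves all the finitely many times involved. -/
theorem not_improving_direction (hadm : (x, u) ∈ P.Iad σ)
    (hopt : P.IsOptimal₁ σ (x, u) ∨ P.IsOptimal₂ σ (x, u) ∨ P.IsOptimal₃ σ (x, u))
    (hXt : ∀ t, IsOpen (P.stateSet t)) (hUconv : ∀ t, Convex ℝ (P.controlSet t))
    (hφ : ∀ t, HasExtFDerivAt (P.φ t) (P.stateSet t ×ˢ P.controlSet t) (Dφ t) (x t, u t))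
    (hf : ∀ t, HasExtFDerivAt (P.f t) (P.stateSet t ×ˢ P.controlSet t) (Df t) (x t, u t))
    {T : ℕ} {y : ℕ → X} {w : ℕ → U} (hy0 : y 0 = 0) (hyT : ∀ t, T < t → y t = 0)
    (hwT : ∀ t, T < t → w t = 0) (hw : ∀ t, u t + w t ∈ P.controlSet t)
    (hint : ∀ t ≤ T, (P.f t (x t, u t) - x (t + 1)) + (Df t (y t, w t) - y (t + 1)) ∈
      interior (Set.Ici (0 : X))) :
    ∑ t ∈ Finset.range (T + 1), Dφ t (y t, w t) ≤ 0 := by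
  obtain ⟨hx, hu, hx0, hdyn⟩ := id hadm
  simp only at hx hu hx0 hdyn
  by_contra! hpos
  have hst (t) : ∀ᶠ ε : ℝ in 𝓝[>] 0, x t + ε • y t ∈ P.stateSet t := by
    have hc : ContinuousAt (fun ε : ℝ => x t + ε • y t) 0 := by fun_prop
    have := hc.tendsto.mono_left (nhdsWithin_le_nhds (s := Set.Ioi 0))
    exact this ((hXt t).mem_nhds (by simpa using hx t))
  have hct : ∀ᶠ ε : ℝ in 𝓝[>] 0, ∀ t, u t + ε • w t ∈ P.controlSet t := by
    have h2 : ∀ᶠ ε : ℝ in 𝓝[>] 0, ε ≤ 1 := nhdsWithin_le_nhds (eventually_le_nhds one_pos)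
    filter_upwards [h2, self_mem_nhdsWithin] with ε h2 h3 t
    exact (hUconv t).add_smul_mem (hu t) (hw t) ⟨le_of_lt h3, h2⟩
  have hmem (t) : ∀ᶠ ε : ℝ in 𝓝[>] 0,
      (x t, u t) + ε • (y t, w t) ∈ P.stateSet t ×ˢ P.controlSet t := by
    filter_upwards [hst t, hct] with ε h1 h2
    exact ⟨h1, h2 t⟩
  have hfeas (t) (ht : t ≤ T) : ∀ᶠ ε : ℝ in 𝓝[>] 0,
      x (t + 1) + ε • y (t + 1) ≤ P.f t (x t + ε • y t, u t + ε • w t) := by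
    have h1 := ((hf t).tendsto_slope ⟨hx t, hu t⟩ (hmem t)).sub_const (y (t + 1))
    filter_upwards [eventually_nonneg_add_smul (sub_nonneg.2 (hdyn t)) (hint t ht) h1,
      self_mem_nhdsWithin] with ε h2 h3
    rw [smul_sub, smul_inv_smul₀ (ne_of_gt h3)] at h2
    rw [← sub_nonneg]
    convert h2 using 1
    simp only [Prod.smul_mk, Prod.mk_add_mk]
    abel
  have hfeas' : ∀ᶠ ε : ℝ in 𝓝[>] 0, ∀ t ∈ Finset.range (T + 1),
      (x t + ε • y t ∈ P.stateSet t) ∧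
      x (t + 1) + ε • y (t + 1) ≤ P.f t (x t + ε • y t, u t + ε • w t) := by
    rw [eventually_all_finset]
    intro t ht
    exact (hst t).and (hfeas t (Nat.lt_succ_iff.1 (Finset.mem_range.1 ht)))
  have hgain := tendsto_finsetSum (Finset.range (T + 1)) fun t _ =>
    (hφ t).tendsto_slope ⟨hx t, hu t⟩ (hmem t)
  obtain ⟨ε, ⟨h1, h2⟩, h3, h4⟩ := ((hfeas'.and hct).and
    ((hgain.eventually (lt_mem_nhds hpos)).and self_mem_nhdsWithin)).exists
  have hz : ((fun t => x t + ε • y t, fun t => u t + ε • w t) : (ℕ → X) × (ℕ → U)) ∈ P.Iad σ := by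
    refine ⟨fun t => ?_, h2, by simp [hy0, hx0], fun t => ?_⟩
    · rcases le_or_gt t T with ht | ht
      · exact (h1 t (Finset.mem_range.2 (Nat.lt_succ_iff.2 ht))).1
      · simpa [hyT t ht] using hx t
    · rcases le_or_gt t T with ht | ht
      · exact (h1 t (Finset.mem_range.2 (Nat.lt_succ_iff.2 ht))).2
      · simpa [hyT t ht, hwT t ht, hyT (t + 1) (by omega)] using hdyn t
  have hle := partialSum_le_of_optimal hopt hz (T := T) fun t ht => by
    simp [hyT t ht, hwT t ht]
  simp only [smul_eq_mul, ← Finset.mul_sum, Finset.sum_sub_distrib] at h3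
  have h5 := pos_of_mul_pos_right h3 (inv_nonneg.2 (le_of_lt h4))
  exact absurd hle (not_le.2 (sub_pos.1 h5))

end FiniteHorizon

/-! ### Multipliers for a fixed horizon -/

section Multipliers

variable {X U : Type*} [NormedAddCommGroup X] [NormedSpace ℝ X] [PartialOrder X]
  [NormedAddCommGroup U] [NormedSpace ℝ U]

/-- `(l, p)` satisfies sign, adjoint and maximum conditions up to time `T`. -/
structure IsMultiplierUpTo (P : ControlSystem X U) (u : ℕ → U)
    (Dφ : ℕ → X × U →L[ℝ] ℝ) (Df : ℕ → X × U →L[ℝ] X) (T : ℕ) (l : ℝ) (p : ℕ → X →L[ℝ] ℝ) :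
    Prop where
  nonneg : 0 ≤ l
  pos : ∀ t h, 0 ≤ h → 0 ≤ p t h
  adjoint : ∀ t, 1 ≤ t → t ≤ T → p t = (p (t + 1)).comp (D₁ (Df t)) + l • D₁ (Dφ t)
  max : ∀ t ≤ T, ∀ v ∈ P.controlSet t,
    (l • D₂ (Dφ t) + (p (t + 1)).comp (D₂ (Df t))) (v - u t) ≤ 0
  eq_zero : ∀ t, T + 1 < t → p t = 0

variable {P : ControlSystem X U} {σ : X} {x : ℕ → X} {u : ℕ → U}
  {Dφ : ℕ → X × U →L[ℝ] ℝ} {Df : ℕ → X × U →L[ℝ] X} {T : ℕ}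

theorem exists_isMultiplierUpTo [IsOrderedAddMonoid X] [IsOrderedModule ℝ X]
    (hX : IsClosed (Set.Ici (0 : X)))
    (hXint : (interior (Set.Ici (0 : X))).Nonempty) (hadm : (x, u) ∈ P.Iad σ)
    (hopt : P.IsOptimal₁ σ (x, u) ∨ P.IsOptimal₂ σ (x, u) ∨ P.IsOptimal₃ σ (x, u))
    (hXt : ∀ t, IsOpen (P.stateSet t)) (hUconv : ∀ t, Convex ℝ (P.controlSet t))
    (hφ : ∀ t, HasExtFDerivAt (P.φ t) (P.stateSet t ×ˢ P.controlSet t) (Dφ t) (x t, u t))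
    (hf : ∀ t, HasExtFDerivAt (P.f t) (P.stateSet t ×ˢ P.controlSet t) (Df t) (x t, u t))
    (T : ℕ) :
    ∃ (l : ℝ) (p : ℕ → X →L[ℝ] ℝ), IsMultiplierUpTo P u Dφ Df T l p ∧
      (l ≠ 0 ∨ ∃ t ≤ T, p (t + 1) ≠ 0) := by
  classical
  obtain ⟨hx, hu, hx0, hdyn⟩ := id hadm
  simp only at hx hu hx0 hdyn
  let dir : (ℕ → X) → (ℕ → U) → Prop := fun y w => y 0 = 0 ∧ (∀ t, T < t → y t = 0) ∧
    (∀ t, T < t → w t = 0) ∧ ∀ t, u t + w t ∈ P.controlSet t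
  let slack : (ℕ → X) → (ℕ → U) → ℕ → X := fun y w t =>
    (P.f t (x t, u t) - x (t + 1)) + (Df t (y t, w t) - y (t + 1))
  let C : Set (ℝ × (Fin (T + 1) → X)) := {c | ∃ y w, dir y w ∧
    c = (∑ t ∈ Finset.range (T + 1), Dφ t (y t, w t), fun i : Fin (T + 1) => slack y w i)}
  have hdir0 : dir 0 0 := ⟨rfl, fun _ _ => rfl, fun _ _ => rfl, fun t => by simpa using hu t⟩
  have hC : Convex ℝ C := by
    rintro _ ⟨y, w, ⟨h1, h2, h3, h4⟩, rfl⟩ _ ⟨y', w', ⟨h1', h2', h3', h4'⟩, rfl⟩ a b ha hb hab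
    have hpair (t) : ((a • y + b • y') t, (a • w + b • w') t)
        = a • (y t, w t) + b • (y' t, w' t) := rfl
    refine ⟨a • y + b • y', a • w + b • w', ⟨by simp [h1, h1'], fun t ht => by
      simp [h2 t ht, h2' t ht], fun t ht => by simp [h3 t ht, h3' t ht], fun t => ?_⟩, ?_⟩
    · have := hUconv t (h4 t) (h4' t) ha hb hab
      convert this using 1
      obtain rfl : b = 1 - a := by linarith
      simp only [Pi.add_apply, Pi.smul_apply]
      module
    · refine Prod.ext ?_ (funext fun i => ?_)
      · simp only [hpair, map_add, map_smul, Finset.sum_add_distrib, ← Finset.smul_sum]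
        rfl
      · simp only [slack, hpair, map_add, map_smul]
        obtain rfl : b = 1 - a := by linarith
        simp only [Prod.snd_add, Prod.smul_snd, Pi.add_apply, Pi.smul_apply]
        module
  obtain ⟨l, q, hl, hq, hne, hle⟩ := exists_nonneg_multipliers hX hXint hC ⟨_, 0, 0, hdir0, rfl⟩ (by
    rintro _ ⟨y, w, ⟨h1, h2, h3, h4⟩, rfl⟩ ⟨hpos, hint⟩
    exact not_lt.2 (not_improving_direction hadm hopt hXt hUconv hφ hf h1 h2 h3 h4
      fun t ht => hint ⟨t, Nat.lt_succ_iff.2 ht⟩) hpos)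
  -- The constraint at time `t` carries `p (t + 1)`. Truncated subtraction makes `p 0 = p 1`, a
  -- harmless default.
  let p : ℕ → X →L[ℝ] ℝ := fun t => if h : t - 1 < T + 1 then q ⟨t - 1, h⟩ else 0
  have hp (i : Fin (T + 1)) : p (i + 1) = q i := by
    simp only [p, Nat.add_sub_cancel, dif_pos i.2]
  have hpos : ∀ t h, 0 ≤ h → 0 ≤ p t h := by
    intro t h hh
    simp only [p]
    split_ifs
    · exact hq _ h hh
    · rfl
  have hle' (y w) (h : dir y w) : l * ∑ t ∈ Finset.range (T + 1), Dφ t (y t, w t)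
      + ∑ t ∈ Finset.range (T + 1), p (t + 1) (slack y w t) ≤ 0 := by
    have := hle _ ⟨y, w, h, rfl⟩
    rw [← Fin.sum_univ_eq_sum_range (fun t => p (t + 1) (slack y w t))]
    simpa only [hp] using this
  have hmain (y w) (h : dir y w) : ∑ t ∈ Finset.range (T + 1),
      (l * Dφ t (y t, w t) + p (t + 1) (Df t (y t, w t)))
        ≤ ∑ t ∈ Finset.range (T + 1), p (t + 1) (y (t + 1)) := by
    have h1 := hle' y w h
    -- Positivity of `p` allows the constant slack of the optimal process to be dropped.
    have h2 : 0 ≤ ∑ t ∈ Finset.range (T + 1), p (t + 1) (P.f t (x t, u t) - x (t + 1)) :=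
      Finset.sum_nonneg fun t _ => hpos _ _ (sub_nonneg.2 (hdyn t))
    simp only [slack, map_add, Finset.sum_add_distrib, map_sub, Finset.sum_sub_distrib] at h1 h2
    rw [Finset.sum_add_distrib, ← Finset.mul_sum]
    linarith
  refine ⟨l, p, ⟨hl, hpos, ?_, ?_, ?_⟩, ?_⟩
  · intro t ht htT
    obtain ⟨k, rfl⟩ : ∃ k, t = k + 1 := ⟨t - 1, by omega⟩
    -- Perturbing only the state at time `k + 1` affects the constraints `k` and `k + 1`; using both
    -- `h` and `-h` yields equality.
    have key (h : X) : l * Dφ (k + 1) (h, 0) + p (k + 1 + 1) (Df (k + 1) (h, 0))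
        ≤ p (k + 1) h := by
      have h1 := hmain (Pi.single (k + 1) h) 0 ⟨by simp, fun t ht => by
        rw [Pi.single_eq_of_ne (by omega)], fun _ _ => rfl, fun t => by simpa using hu t⟩
      rw [Finset.sum_eq_single_of_mem (k + 1) (by simp; omega) (fun j _ hj => by
          simp [Pi.single_eq_of_ne hj, Prod.mk_zero_zero]),
        Finset.sum_eq_single_of_mem k (by simp; omega) (fun j _ hj => by
          simp [Pi.single_eq_of_ne (show j + 1 ≠ k + 1 by omega)])] at h1
      simpa using h1
    ext h
    have h1 := key h
    have h2 := key (-h)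
    have h3 : ((-h, 0) : X × U) = -(h, 0) := by simp
    rw [h3] at h2
    simp only [map_neg] at h2
    simp only [D₁, add_apply, smul_apply, ContinuousLinearMap.comp_apply,
      ContinuousLinearMap.inl_apply, smul_eq_mul]
    linarith
  · intro t ht v hv
    have h1 := hmain 0 (Pi.single t (v - u t)) ⟨rfl, fun _ _ => rfl, fun j hj => by
      rw [Pi.single_eq_of_ne (by omega)], fun j => by
        rcases eq_or_ne j t with rfl | hj
        · simpa using hv
        · simpa [Pi.single_eq_of_ne hj] using hu j⟩
    rw [Finset.sum_eq_single_of_mem t (by simp; omega) (fun j _ hj => by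
      simp [Pi.single_eq_of_ne hj, Prod.mk_zero_zero])] at h1
    simpa [D₂] using h1
  · intro t ht
    simp only [p]
    rw [dif_neg (by omega)]
  · refine hne.imp_right fun ⟨i, hi⟩ => ⟨i, Nat.lt_succ_iff.1 i.2, ?_⟩
    rwa [hp]

namespace IsMultiplierUpTo

variable {l : ℝ} {p : ℕ → X →L[ℝ] ℝ}

theorem le_zero_of_mem_tangentCone (h : IsMultiplierUpTo P u Dφ Df T l p) {t : ℕ} (ht : t ≤ T)
    {v : U} (hv : v ∈ tangentCone (P.controlSet t) (u t)) :
    (l • D₂ (Dφ t) + (p (t + 1)).comp (D₂ (Df t))) v ≤ 0 := by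
  refine closure_minimal (s := {w | ∃ α : ℝ, 0 ≤ α ∧ ∃ v ∈ P.controlSet t, w = α • (v - u t)})
    (t := {v | (l • D₂ (Dφ t) + (p (t + 1)).comp (D₂ (Df t))) v ≤ 0}) ?_ ?_ hv
  · rintro _ ⟨α, hα, v, hv, rfl⟩
    rw [Set.mem_ofPred_eq, map_smul]
    exact mul_nonpos_of_nonneg_of_nonpos hα (h.max t ht v hv)
  · exact isClosed_le (ContinuousLinearMap.continuous _) continuous_const

theorem smul (h : IsMultiplierUpTo P u Dφ Df T l p) {c : ℝ} (hc : 0 ≤ c) :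
    IsMultiplierUpTo P u Dφ Df T (c * l) (fun t => c • p t) where
  nonneg := mul_nonneg hc h.nonneg
  pos t z hz := mul_nonneg hc (h.pos t z hz)
  adjoint t ht htT := by
    rw [h.adjoint t ht htT, smul_add, smul_smul, ContinuousLinearMap.smul_comp]
  max t ht v hv := by
    have := mul_nonpos_of_nonneg_of_nonpos hc (h.max t ht v hv)
    simp only [add_apply, smul_apply, ContinuousLinearMap.comp_apply, smul_eq_mul] at this ⊢
    linarith
  eq_zero t ht := by rw [h.eq_zero t ht, smul_zero]

/-- Write a point of the ball as `Df t (y, v)`. The adjoint equation handles `y` and the maximum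
condition handles `v`, giving `p (t + 1) (Df t (y, v)) ≤ p t y - l * Dφ t (y, v)`. -/
theorem opNorm_succ_le (h : IsMultiplierUpTo P u Dφ Df T l p) {t : ℕ} (h1 : 1 ≤ t) (ht : t ≤ T)
    {r : ℝ} (hr : 0 < r) (hball : Metric.closedBall (0 : X) r ⊆
      Df t '' ((Set.univ ×ˢ tangentCone (P.controlSet t) (u t)) ∩ Metric.closedBall 0 1)) :
    ‖p (t + 1)‖ ≤ (‖p t‖ + l * ‖Dφ t‖) / r := by
  refine ContinuousLinearMap.opNorm_le_div_of_le hr fun z hz => ?_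
  obtain ⟨⟨y, v⟩, ⟨⟨-, hv⟩, hyv⟩, rfl⟩ := hball hz
  have hyv' : ‖(y, v)‖ ≤ 1 := by simpa using hyv
  have hy : ‖y‖ ≤ 1 := (norm_fst_le (y, v)).trans hyv'
  have hmax := h.le_zero_of_mem_tangentCone ht hv
  have hadj := congrArg (fun q : X →L[ℝ] ℝ => q y) (h.adjoint t h1 ht)
  have hdec : (y, v) = (y, 0) + (0, v) := by simp
  simp only [D₁, D₂, add_apply, smul_apply, ContinuousLinearMap.comp_apply,
    ContinuousLinearMap.inl_apply, ContinuousLinearMap.inr_apply, smul_eq_mul] at hmax hadj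
  have h2 : Dφ t (y, v) = Dφ t (y, 0) + Dφ t (0, v) := by rw [hdec, map_add]
  have h3 : p (t + 1) (Df t (y, v)) = p (t + 1) (Df t (y, 0)) + p (t + 1) (Df t (0, v)) := by
    rw [hdec, map_add, map_add]
  have h4 : p t y ≤ ‖p t‖ :=
    (le_abs_self _).trans ((p t).unit_le_opNorm y hy)
  have h5 : -Dφ t (y, v) ≤ ‖Dφ t‖ :=
    (neg_le_abs _).trans ((Dφ t).unit_le_opNorm _ hyv')
  have h6 := mul_le_mul_of_nonneg_left h5 h.nonneg
  rw [h3]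
  rw [h2] at h6
  linarith

end IsMultiplierUpTo

end Multipliers

/-! ### Nontriviality and bounds uniform in the horizon -/

section Limit

variable {X U : Type*} [NormedAddCommGroup X] [NormedSpace ℝ X] [PartialOrder X]
  [NormedAddCommGroup U] [NormedSpace ℝ U] {P : ControlSystem X U} {u : ℕ → U}
  {Dφ : ℕ → X × U →L[ℝ] ℝ} {Df : ℕ → X × U →L[ℝ] X}

namespace IsMultiplierUpTo

/-- Under the surjectivity condition on the differentials, `(l, p t)` cannot vanish. -/
theorem pos_of_ne_zero {T : ℕ} {l : ℝ} {p : ℕ → X →L[ℝ] ℝ} (h : IsMultiplierUpTo P u Dφ Df T l p)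
    (hball : ∀ t, 1 ≤ t → ∃ r > 0, Metric.closedBall (0 : X) r ⊆
      Df t '' ((Set.univ ×ˢ tangentCone (P.controlSet t) (u t)) ∩ Metric.closedBall 0 1))
    (hne : l ≠ 0 ∨ ∃ t ≤ T, p (t + 1) ≠ 0) {e : X} (he : e ∈ interior (Set.Ici (0 : X))) :
    0 < l + p 1 e := by
  have hpe : 0 ≤ p 1 e := h.pos 1 e (interior_subset he)
  refine lt_of_le_of_ne (add_nonneg h.nonneg hpe) fun h0 => ?_
  have hl : l = 0 := by linarith [h.nonneg]
  have hp : p 1 e = 0 := by linarith [h.nonneg]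
  obtain ⟨r, hr, hcone⟩ := exists_pos_opNorm_le_of_mem_interior he
  have hall : ∀ t, t ≤ T → p (t + 1) = 0 := by
    intro t
    induction t with
    | zero =>
      intro _
      have := hcone (p 1) (h.pos 1)
      rw [hp, zero_div] at this
      exact norm_le_zero_iff.1 this
    | succ t ih =>
      intro ht
      obtain ⟨r', hr', hb⟩ := hball (t + 1) (by omega)
      have := h.opNorm_succ_le (by omega) ht hr' hb
      rw [ih (by omega), hl, norm_zero, zero_mul, add_zero, zero_div] at this
      exact norm_le_zero_iff.1 this
  rcases hne with hne | ⟨t, ht, hne⟩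
  · exact hne hl
  · exact hne (hall t ht)

/-- Normalized multipliers are bounded at each time, uniformly in the horizon. -/
theorem exists_opNorm_le
    (hball : ∀ t, 1 ≤ t → ∃ r > 0, Metric.closedBall (0 : X) r ⊆
      Df t '' ((Set.univ ×ˢ tangentCone (P.controlSet t) (u t)) ∩ Metric.closedBall 0 1))
    {e : X} (he : e ∈ interior (Set.Ici (0 : X))) (t : ℕ) :
    ∃ M, ∀ (T : ℕ) (l : ℝ) (p : ℕ → X →L[ℝ] ℝ), IsMultiplierUpTo P u Dφ Df T l p →
      l + p 1 e = 1 → ‖p (t + 1)‖ ≤ M := by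
  induction t with
  | zero =>
    obtain ⟨r, hr, hcone⟩ := exists_pos_opNorm_le_of_mem_interior he
    refine ⟨1 / r, fun T l p h hn => (hcone _ (h.pos _)).trans ?_⟩
    have : p 1 e ≤ 1 := by linarith [h.nonneg]
    gcongr
  | succ t ih =>
    obtain ⟨M, hM⟩ := ih
    obtain ⟨r, hr, hb⟩ := hball (t + 1) (by omega)
    refine ⟨(M + 1 * ‖Dφ (t + 1)‖) / r, fun T l p h hn => ?_⟩
    have h1 : ‖p (t + 1)‖ ≤ M := hM T l p h hn
    have h2 : l ≤ 1 := by linarith [h.pos 1 e (interior_subset he)]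
    rcases le_or_gt (t + 1) T with ht | ht
    · refine (h.opNorm_succ_le (by omega) ht hr hb).trans ?_
      gcongr
    -- Beyond the horizon the multiplier is zero, so the same bound holds.
    · rw [h.eq_zero _ (by omega), norm_zero]
      have := (norm_nonneg _).trans h1
      positivity

end IsMultiplierUpTo

end Limit

/-! ### Passage to the infinite horizon -/

/-- A bounded sequence of functionals has a pointwise limit along any ultrafilter. -/
theorem exists_tendsto_apply_of_opNorm_le {ι X : Type*} [NormedAddCommGroup X]
    [NormedSpace ℝ X] (F : Ultrafilter ι) {p : ι → X →L[ℝ] ℝ}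
    {M : ℝ} (h : ∀ i, ‖p i‖ ≤ M) :
    ∃ q : X →L[ℝ] ℝ, ∀ z, Tendsto (fun i => p i z) F (𝓝 (q z)) := by
  obtain ⟨q, -, hq⟩ := (WeakDual.isCompact_closedBall (0 : StrongDual ℝ X) M).ultrafilter_le_nhds
    (F.map fun i => StrongDual.toWeakDual (p i)) (by
      rw [Ultrafilter.coe_map, Filter.le_principal_iff, Filter.mem_map]
      exact Filter.Eventually.of_forall fun i => by simpa using h i)
  exact ⟨WeakDual.toStrongDual q, fun z => ((WeakDual.eval_continuous z).tendsto q).comp hq⟩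

open DiscreteControl in
theorem theorem2p3
    {X U : Type*}
    [NormedAddCommGroup X] [NormedSpace ℝ X] [CompleteSpace X]
    [PartialOrder X] [IsOrderedAddMonoid X] [IsOrderedModule ℝ X]
    [NormedAddCommGroup U] [NormedSpace ℝ U] [CompleteSpace U]
    -- the positive cone is closed, with nonempty interior
    (hXclosed : IsClosed (Set.Ici (0 : X)))
    (hXint : (interior (Set.Ici (0 : X))).Nonempty)
    (P : ControlSystem X U) (σ : X) (hσ : σ ∈ P.stateSet 0)
    (x : ℕ → X) (u : ℕ → U)
    (hopt : P.IsOptimal₁ σ (x, u) ∨ P.IsOptimal₂ σ (x, u) ∨ P.IsOptimal₃ σ (x, u))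
    -- (A1), and convexity of the control sets
    (hXt : ∀ t, IsOpen (P.stateSet t) ∧ (P.stateSet t).Nonempty)
    (hUt : ∀ t, (P.controlSet t).Nonempty)
    (hUconv : ∀ t, Convex ℝ (P.controlSet t))
    -- (A2)
    (hsep : TopologicalSpace.SeparableSpace X)
    -- (A3), with the differentials of the rewards and of the dynamics along the process
    (Dφ : ℕ → X × U →L[ℝ] ℝ) (Df : ℕ → X × U →L[ℝ] X)
    (hφ : ∀ t, HasExtFDerivAt (P.φ t) (P.stateSet t ×ˢ P.controlSet t) (Dφ t) (x t, u t))
    (hf : ∀ t, HasContExtFDerivAt (P.f t) (P.stateSet t ×ˢ P.controlSet t) (Df t) (x t, u t))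
    -- (A4)
    (hA4 : ∀ t, 1 ≤ t → (0 : X) ∈ interior
      (Df t '' ((Set.univ ×ˢ tangentCone (P.controlSet t) (u t)) ∩ Metric.closedBall 0 1)))
    -- (A5)
    (hA5 : ∀ t, IsClosed (Set.range (D₂ (Df t))) ∧
      FiniteDimensional ℝ (X ⧸ (D₂ (Df t)).range))
    -- (A6)
    (s : ℕ)
    (hA6 : ∃ K ⊆ D₂ (Df s) '' tangentCone (P.controlSet s) (u s),
      IsClosed K ∧ Convex ℝ K ∧ (intrinsicInterior ℝ K).Nonempty ∧ AffineHullFiniteCodim K) :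
    -- only the values `p t` with `1 ≤ t` are meaningful
    ∃ (l₀ : ℝ) (p : ℕ → X →L[ℝ] ℝ),
      (∀ t, 1 ≤ t → s ≤ t → (l₀, p t) ≠ (0, 0)) ∧
      (0 ≤ l₀ ∧ ∀ t, 1 ≤ t → ∀ h : X, 0 ≤ h → 0 ≤ p t h) ∧
      (∀ t, 1 ≤ t → p t = (p (t + 1)).comp (D₁ (Df t)) + l₀ • D₁ (Dφ t)) ∧
      (∀ t, ∀ v ∈ P.controlSet t,
        (l₀ • D₂ (Dφ t) + (p (t + 1)).comp (D₂ (Df t))) (v - u t) ≤ 0) := by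
  have hadm : (x, u) ∈ P.Iad σ := by
    rcases hopt with h | h | h <;> exact h.1
  obtain ⟨e, he⟩ := id hXint
  have hball : ∀ t, 1 ≤ t → ∃ r > 0, Metric.closedBall (0 : X) r ⊆
      Df t '' ((Set.univ ×ˢ tangentCone (P.controlSet t) (u t)) ∩ Metric.closedBall 0 1) :=
    fun t ht => Metric.nhds_basis_closedBall.mem_iff.1 (mem_interior_iff_mem_nhds.1 (hA4 t ht))
  have hfin (T : ℕ) : ∃ (l : ℝ) (p : ℕ → X →L[ℝ] ℝ),
      IsMultiplierUpTo P u Dφ Df T l p ∧ l + p 1 e = 1 := by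
    obtain ⟨l, p, h, hne⟩ := exists_isMultiplierUpTo hXclosed hXint hadm hopt
      (fun t => (hXt t).1) hUconv hφ (fun t => (hf t).hasExtFDerivAt) T
    have hpos := h.pos_of_ne_zero hball hne he
    refine ⟨_, _, h.smul (inv_nonneg.2 hpos.le), ?_⟩
    rw [smul_apply, smul_eq_mul, ← mul_add, inv_mul_cancel₀ hpos.ne']
  choose l p hmul hnorm using hfin
  choose M hM using fun t => IsMultiplierUpTo.exists_opNorm_le (Dφ := Dφ) hball he t
  -- A single nonprincipal ultrafilter gives limits at all times at once, replacing a diagonal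
  -- extraction.
  let F : Ultrafilter ℕ := Filter.hyperfilter ℕ
  have hF (T : ℕ) : ∀ᶠ n in (F : Filter ℕ), T ≤ n :=
    Nat.hyperfilter_le_atTop (Filter.eventually_ge_atTop T)
  choose q hq using fun t => exists_tendsto_apply_of_opNorm_le F
    (p := fun n => p n (t + 1)) (fun n => hM t n _ _ (hmul n) (hnorm n))
  -- The normalization determines `l n` from `p n 1 e`; `q t` is the limit of `p n (t + 1)`.
  have hl : Filter.Tendsto l F (nhds (1 - q 0 e)) := by
    refine (tendsto_const_nhds.sub (hq 0 e)).congr fun n => ?_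
    linarith [hnorm n]
  have hpos (t : ℕ) (h : X) (hh : 0 ≤ h) : 0 ≤ q t h :=
    ge_of_tendsto' (hq t h) fun n => (hmul n).pos _ _ hh
  have hadj (t : ℕ) : q t = (q (t + 1)).comp (D₁ (Df (t + 1)))
      + (1 - q 0 e) • D₁ (Dφ (t + 1)) := by
    ext h
    refine tendsto_nhds_unique (hq t h) (((hq (t + 1) (D₁ (Df (t + 1)) h)).add
      (hl.mul_const (D₁ (Dφ (t + 1)) h))).congr' ?_)
    filter_upwards [hF (t + 1)] with n hn
    exact congrArg (fun g : X →L[ℝ] ℝ => g h) ((hmul n).adjoint (t + 1) (by omega) hn).symm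
  -- With `l₀ = 0`, the adjoint equation carries `q t = 0` back to `q 0 = 0`, but then `l₀ = 1`.
  have hne (t : ℕ) : ¬ (1 - q 0 e = 0 ∧ q t = 0) := by
    rintro ⟨h0, ht⟩
    have hzero : q 0 = 0 := by
      induction t with
      | zero => exact ht
      | succ t ih => exact ih (by rw [hadj t, h0, ht]; simp)
    simp [hzero] at h0
  refine ⟨1 - q 0 e, fun t => q (t - 1), ?_, ⟨?_, ?_⟩, ?_, ?_⟩
  · intro t _ _ h
    exact hne _ (Prod.mk.inj h)
  · exact ge_of_tendsto' hl fun n => (hmul n).nonneg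
  · exact fun t _ => hpos _
  · intro t ht
    obtain ⟨k, rfl⟩ : ∃ k, t = k + 1 := ⟨t - 1, by omega⟩
    exact hadj k
  · intro t v hv
    refine le_of_tendsto ((hl.mul_const (D₂ (Dφ t) (v - u t))).add
      (hq t (D₂ (Df t) (v - u t)))) ?_
    filter_upwards [hF t] with n hn
    exact (hmul n).max t hn v hv
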